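/- **Setting.** There are $N$ vehicles $i=1,\dots,N$, pickups $P=\{1,\dots,n\}$, and deliveries $D=\{n+1,\dots,2n\}$, where $j+n$ is the delivery of pickup $j$; put $R=P\cup D$. The routing graph has vertices $V_A=\{s,\sigma\}\cup R$ and edges $\mathcal E_A=\{(j,k): j\ne k,\ j\neq\sigma,\ k\neq s\}$. The data are costs $c_i^{jk}\ge 0$, travel times $t_i^{jk}\ge 0$, service times $d^j\ge0$ and demands $q^j$ with $d^s=d^\sigma=q^s=q^\sigma=0$, $q^j>0$ for $j\in P$, $q^j<0$ for $j\in D$, capacities $C_i\ge 0$ and initial loads $Q_i^{\rm init}\ge0$. Let $\underline Q^j=\max\{0,q^j\}$ and $\overline Q_i^j=\min\{C_i,C_i+q^j\}$. A *route* of vehicle $i$ is $z_i=(x_i,B_i,Q_i)$ with $x_i^{jk}\in\{0,1\}$ for $(j,k)\in\mathcal E_A$ and $B_i^j\ge0$, $Q_i^j\geq 0$ for $j\in V_A$, such that $\sum_k x_i^{sk}=1$, $\sum_j x_i^{j\sigma}=1$, $\sum_j x_i^{jk}=\sum_j x_i^{kj}$ for $k\in R$, $\sum_k x_i^{jk}=\sum_k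 x_i^{j+n,k}$ and $B_i^j\le B_i^{j+n}$ for $j\in P$, $\underline Q^j\le Q_i^j\le\overline Q_i^j$ for $j\in V_A$, $Q_i^s=Q_i^{\rm init}$, and, for every edge, $x_i^{jk}=1\Rightarrow B_i^k\ge B_i^j+d^j+t_i^{jk}$ and $x_i^{jk}=1\Rightarrow Q_i^k=Q_i^j+q^k$ (all sums run over edges in $\mathcal E_A$). The PDVRP is to minimize $\sum_i\sum_{(j,k)}c_i^{jk}x_i^{jk}$ over routes $z_1,\dots,z_N$ such that $\sum_i\sum_k x_i^{jk}\ge1$ for all $j\in R$. Assume that it is feasible and has an optimal solution. In the PDVRP MILP the two implications are replaced by linear constraints: one takes bounds $\overline B_i\geq 0$ that preserve the solutions (every route of vehicle $i$ stays a route after replacing $B_i$ by some $B_i'\le\overline B_i$), and requires $B_i^j\le\overline B_i$, $B_i^k\ge B_i^j+d^j+t_i^{jk}-M_i^{jk}(1-x_i^{jk})$, $Q_i^k\ge Q_i^j+q^k-\overline W_i^{jk}(1-x_i^{jk})$ and $Q_i^k\le Q_i^j+q^k+\underline W_i^{jk}(1-x_i^{jk})$, for constants $M_i^{jk}\ge\overline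 B_i+d^j+t_i^{jk}$, $\overline W_i^{jk}\ge\overline Q_i^j+q^k$, $\underline W_i^{jk}\ge\overline Q_i^k-q^k-\underline Q^j$. Let $Z_i$ be the set of all $z_i$ that satisfy these local constraints of vehicle $i$. **Algorithm.** Let $\mathcal G$ be a connected undirected communication graph on the vehicles, with neighbor sets $\mathcal N_i$. Let $0<\delta<1$, $M>0$, $T_f\in\mathbb N$ and step sizes $\alpha^t$ be given. Start with $[y_i^0]_j=\delta/N$ for all $j\in R$. For $t=0,\dots,T_f-1$ each vehicle takes a Lagrange multiplier $\mu_i^t\in\mathbb R^{R}_{\ge0}$, for the constraints indexed by $j\in R$, of $$\min\ \sum_{(j,k)}c_i^{jk}x_i^{jk}+Mv_i\quad\text{s.t.}\quad \sum_k x_i^{jk}\ge[y_i^t]_j-v_i\ \ \forall j\in R,\qquad (x_i,B_i,Q_i)\in\operatorname{conv}Z_i,\ v_i\ge0,$$ and sets $y_i^{t+1}=y_i^t-\alpha^t\sum_{\ell\in\mathcal N_i}(\mu_i^t-\mu_\ell^t)$. Finally each vehicle sets $[y_i^{\rm end}]_j=\min([y_i^{T_f}]_j,1)$ and returns an optimal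 solution $z_i^{\rm end}$ of the local MILP $$\min\ \sum_{(j,k)}c_i^{jk}x_i^{jk}\quad\text{s.t.}\quad \sum_k x_i^{jk}\ge[y_i^{\rm end}]_j\ \ \forall j\in R,\qquad (x_i,B_i,Q_i)\in Z_i.$$ **Theorem (finite-time feasibility).** Assume $\alpha^t\ge0$, $\sum_t\alpha^t=\infty$, $\sum_t(\alpha^t)^2<\infty$ and $0<\delta<1$. Then for all sufficiently large $M>0$ the Lagrange multipliers required by the algorithm exist (for every vehicle and every allocation vector), and there is a time $T_\delta>0$ such that, whenever $T_f\ge T_\delta$, every aggregate output $(z_1^{\rm end},\dots,z_N^{\rm end})$ of the algorithm is a feasible solution of the PDVRP MILP, hence also of the PDVRP. If moreover every vehicle $i$ has sufficient capacity to serve all the requests (that is, the requests can be ordered, each pickup before its delivery, so that the running load, starting from $Q_i^{\rm init}$ and changing by $q^j$ at each request $j$, lies in $[\underline Q^j,\overline Q_i^j]$ after each request $j$), then for these $T_f$ the final local MILPs of every run of the algorithm have optimal solutions, so that an output exists. -/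

import Mathlib

open scoped BigOperators

namespace PDVRP

/-- Transportation requests for `n` pickup/delivery pairs: `Sum.inl j` is the `j`-th pickup and
`Sum.inr j` is the delivery associated with it (the request `j + |P|`). -/
abbrev Request (n : ℕ) : Type := Fin n ⊕ Fin n

/-- Vertices of the routing graph: the starting point `s`, the requests, the ending point `σ`. -/
inductive Loc (n : ℕ) : Type
  | start : Loc n
  | req : Request n → Loc n
  | terminal : Loc n
  deriving DecidableEq, Fintype

/-- Edges of the routing graph: ordered pairs `(j, k)` with `j ≠ k`, `j ≠ σ`, `k ≠ s`. -/
abbrev Edge (n : ℕ) : Type :=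
  {e : Loc n × Loc n // e.1 ≠ e.2 ∧ e.1 ≠ Loc.terminal ∧ e.2 ≠ Loc.start}

/-- The decision vector `z = (x, B, Q)` of a single vehicle. -/
abbrev Decision (n : ℕ) : Type := (Edge n → ℝ) × (Loc n → ℝ) × (Loc n → ℝ)

section

variable {N n : ℕ}

/-- The arc variables `x`. -/
def Decision.x (z : Decision n) : Edge n → ℝ := z.1

/-- The times `B` at which service begins. -/
def Decision.B (z : Decision n) : Loc n → ℝ := z.2.1

/-- The loads `Q` when leaving a location. -/
def Decision.Q (z : Decision n) : Loc n → ℝ := z.2.2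

/-- `∑_{k : (j,k) ∈ E} x^{jk}`. -/
noncomputable def outflow (x : Edge n → ℝ) (j : Loc n) : ℝ :=
  ∑ e : Edge n with e.1.1 = j, x e

/-- `∑_{j : (j,k) ∈ E} x^{jk}`. -/
noncomputable def inflow (x : Edge n → ℝ) (k : Loc n) : ℝ :=
  ∑ e : Edge n with e.1.2 = k, x e

end

/-- Data of a pickup-and-delivery vehicle routing problem with `N` vehicles and `n` pickup/delivery
pairs. -/
structure Data (N n : ℕ) where
  /-- travel costs `c_i^{jk}` -/
  c : Fin N → Edge n → ℝ
  /-- travel times `t_i^{jk}` -/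
  t : Fin N → Edge n → ℝ
  /-- service times `d^j` -/
  d : Loc n → ℝ
  /-- demands `q^j` -/
  q : Loc n → ℝ
  /-- capacities `C_i` -/
  C : Fin N → ℝ
  /-- loads of the vehicles at the start -/
  Q₀ : Fin N → ℝ
  c_nonneg : ∀ i e, 0 ≤ c i e
  t_nonneg : ∀ i e, 0 ≤ t i e
  d_nonneg : ∀ j, 0 ≤ d j
  d_start : d Loc.start = 0
  d_terminal : d Loc.terminal = 0
  q_start : q Loc.start = 0
  q_terminal : q Loc.terminal = 0
  q_pickup : ∀ j, 0 < q (Loc.req (Sum.inl j))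
  q_delivery : ∀ j, q (Loc.req (Sum.inr j)) < 0
  C_nonneg : ∀ i, 0 ≤ C i
  Q₀_nonneg : ∀ i, 0 ≤ Q₀ i

namespace Data

variable {N n : ℕ}

/-- Lower load bound `max {0, q^j}`. -/
noncomputable def loadMin (S : Data N n) (j : Loc n) : ℝ := max 0 (S.q j)

/-- Upper load bound `min {C_i, C_i + q^j}`. -/
noncomputable def loadMax (S : Data N n) (i : Fin N) (j : Loc n) : ℝ :=
  min (S.C i) (S.C i + S.q j)

/-- The routing cost `∑_{(j,k) ∈ E} c_i^{jk} x^{jk}` of vehicle `i`. -/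
noncomputable def cost (S : Data N n) (i : Fin N) (z : Decision n) : ℝ :=
  ∑ e : Edge n, S.c i e * z.x e

/-- The constraints on vehicle `i` that do not couple arc variables with times or loads. -/
structure BasicConstraints (S : Data N n) (i : Fin N) (z : Decision n) : Prop where
  leaves_start : outflow z.x Loc.start = 1
  enters_terminal : inflow z.x Loc.terminal = 1
  flow : ∀ k : Request n, inflow z.x (Loc.req k) = outflow z.x (Loc.req k)
  paired : ∀ j : Fin n,
    outflow z.x (Loc.req (Sum.inl j)) = outflow z.x (Loc.req (Sum.inr j))
  precedence : ∀ j : Fin n, z.B (Loc.req (Sum.inl j)) ≤ z.B (Loc.req (Sum.inr j))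
  time_nonneg : ∀ j, 0 ≤ z.B j
  load_lower : ∀ j, S.loadMin j ≤ z.Q j
  load_upper : ∀ j, z.Q j ≤ S.loadMax i j
  load_start : z.Q Loc.start = S.Q₀ i
  binary : ∀ e, z.x e = 0 ∨ z.x e = 1

/-- All the constraints on vehicle `i`, with the time and load constraints along the travelled arcs
written as implications. -/
structure IsRoute (S : Data N n) (i : Fin N) (z : Decision n) : Prop
    extends BasicConstraints S i z where
  time_step : ∀ e : Edge n, z.x e = 1 → z.B e.1.1 + S.d e.1.1 + S.t i e ≤ z.B e.1.2
  load_step : ∀ e : Edge n, z.x e = 1 → z.Q e.1.2 = z.Q e.1.1 + S.q e.1.2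

/-- The coupling constraint: every request is served at least once. -/
def Covers (_S : Data N n) (z : Fin N → Decision n) : Prop :=
  ∀ j : Request n, 1 ≤ ∑ i, outflow (z i).x (Loc.req j)

/-- Feasibility for the routing problem (with implications). -/
def IsFeasible (S : Data N n) (z : Fin N → Decision n) : Prop :=
  (∀ i, S.IsRoute i (z i)) ∧ S.Covers z

/-- Optimality for the routing problem (with implications). -/
def IsOptimal (S : Data N n) (z : Fin N → Decision n) : Prop :=
  S.IsFeasible z ∧ ∀ z', S.IsFeasible z' → ∑ i, S.cost i (z i) ≤ ∑ i, S.cost i (z' i)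

/-- Vehicle `i` has sufficient capacity for all the requests: they can be ordered, with each pickup
before its delivery, so that the load of a vehicle that starts with its initial load and serves
them in this order is within the bounds after each service. -/
def CanServeAll (S : Data N n) (i : Fin N) : Prop :=
  ∃ r : Fin (2 * n) ≃ Request n,
    (∀ j : Fin n, r.symm (Sum.inl j) < r.symm (Sum.inr j)) ∧
    ∀ m : Fin (2 * n),
      S.loadMin (Loc.req (r m)) ≤ S.Q₀ i + ∑ l ∈ Finset.Iic m, S.q (Loc.req (r l)) ∧
      S.Q₀ i + ∑ l ∈ Finset.Iic m, S.q (Loc.req (r l)) ≤ S.loadMax i (Loc.req (r m))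

end Data

/-- Constants for the mixed-integer linear formulation: upper bounds `B̄_i` on the times, which
preserve the solutions of the original problem (every route remains possible after a change of its
times), and sufficiently large constants for the linearized implications. -/
structure Linearization {N n : ℕ} (S : Data N n) where
  Bbar : Fin N → ℝ
  bigM : Fin N → Edge n → ℝ
  Wup : Fin N → Edge n → ℝ
  Wlow : Fin N → Edge n → ℝ
  Bbar_nonneg : ∀ i, 0 ≤ Bbar i
  preserves : ∀ i z, S.IsRoute i z →
    ∃ B' : Loc n → ℝ, S.IsRoute i (z.x, B', z.Q) ∧ ∀ j, B' j ≤ Bbar i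
  bigM_ge : ∀ i e, Bbar i + S.d e.1.1 + S.t i e ≤ bigM i e
  Wup_ge : ∀ i e, S.loadMax i e.1.1 + S.q e.1.2 ≤ Wup i e
  Wlow_ge : ∀ i e, S.loadMax i e.1.2 - S.q e.1.2 - S.loadMin e.1.1 ≤ Wlow i e

namespace Linearization

variable {N n : ℕ} {S : Data N n}

/-- The mixed-integer linear constraints on vehicle `i`. -/
structure IsLocal (L : Linearization S) (i : Fin N) (z : Decision n) : Prop
    extends S.BasicConstraints i z where
  time_le : ∀ j, z.B j ≤ L.Bbar i
  time_step : ∀ e : Edge n,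
    z.B e.1.1 + S.d e.1.1 + S.t i e - L.bigM i e * (1 - z.x e) ≤ z.B e.1.2
  load_step_ge : ∀ e : Edge n,
    z.Q e.1.1 + S.q e.1.2 - L.Wup i e * (1 - z.x e) ≤ z.Q e.1.2
  load_step_le : ∀ e : Edge n,
    z.Q e.1.2 ≤ z.Q e.1.1 + S.q e.1.2 + L.Wlow i e * (1 - z.x e)

/-- The set `Z_i` of admissible decisions of vehicle `i`. -/
def Z (L : Linearization S) (i : Fin N) : Set (Decision n) := {z | L.IsLocal i z}

/-- Feasibility for the mixed-integer linear program. -/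
def IsFeasible (L : Linearization S) (z : Fin N → Decision n) : Prop :=
  (∀ i, z i ∈ L.Z i) ∧ S.Covers z

/-- Pairs `(z, v)` with `z ∈ conv Z_i` and `v ≥ 0`. -/
def relaxedDomain (L : Linearization S) (i : Fin N) : Set (Decision n × ℝ) :=
  {p | p.1 ∈ convexHull ℝ (L.Z i) ∧ 0 ≤ p.2}

/-- The feasible set of the local linear program of vehicle `i` with allocation `y`. -/
def relaxedFeasible (L : Linearization S) (i : Fin N) (y : Request n → ℝ) :
    Set (Decision n × ℝ) :=
  {p | p ∈ L.relaxedDomain i ∧ ∀ j, y j - p.2 ≤ outflow p.1.x (Loc.req j)}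

/-- The objective `∑ c_i^{jk} x^{jk} + M v` of the local linear program. -/
noncomputable def penalizedCost (_L : Linearization S) (i : Fin N) (M : ℝ)
    (p : Decision n × ℝ) : ℝ :=
  S.cost i p.1 + M * p.2

/-- The Lagrangian of the local linear program for the allocation constraints. -/
noncomputable def lagrangian (L : Linearization S) (i : Fin N) (M : ℝ) (y μ : Request n → ℝ)
    (p : Decision n × ℝ) : ℝ :=
  L.penalizedCost i M p + ∑ j, μ j * (y j - p.2 - outflow p.1.x (Loc.req j))

/-- `μ` is a Lagrange multiplier for the allocation constraints of the local linear program: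
it is nonnegative and the optimal value is the infimum of the Lagrangian. -/
def IsLagrangeMultiplier (L : Linearization S) (i : Fin N) (M : ℝ) (y μ : Request n → ℝ) : Prop :=
  (∀ j, 0 ≤ μ j) ∧
    ∃ p : ℝ, IsLeast (L.penalizedCost i M '' L.relaxedFeasible i y) p ∧
      IsGLB (L.lagrangian i M y μ '' L.relaxedDomain i) p

/-- The iterative part of the distributed algorithm: `y t i` and `μ t i` are the allocation and the
multiplier of vehicle `i` at iteration `t`, for `Tf` iterations. -/
structure IsRun (L : Linearization S) (G : SimpleGraph (Fin N)) [DecidableRel G.Adj]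
    (α : ℕ → ℝ) (δ M : ℝ) (Tf : ℕ) (y μ : ℕ → Fin N → Request n → ℝ) : Prop where
  initial : ∀ i j, y 0 i j = δ / N
  multiplier : ∀ t < Tf, ∀ i, L.IsLagrangeMultiplier i M (y t i) (μ t i)
  update : ∀ t < Tf, ∀ i j,
    y (t + 1) i j = y t i j - α t * ∑ l ∈ G.neighborFinset i, (μ t i j - μ t l j)

/-- `z` is an optimal solution of the local mixed-integer linear program of vehicle `i` with
allocation `y`. -/
def IsLocalOptimal (L : Linearization S) (i : Fin N) (y : Request n → ℝ) (z : Decision n) :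
    Prop :=
  (z ∈ L.Z i ∧ ∀ j, y j ≤ outflow z.x (Loc.req j)) ∧
    ∀ z' ∈ L.Z i, (∀ j, y j ≤ outflow z'.x (Loc.req j)) → S.cost i z ≤ S.cost i z'

/-- The last part of the algorithm: from the allocations `y`, the vehicles return `z`, solving their
local programs with the thresholded allocations `min (y, 1)`. -/
def IsReturned (L : Linearization S) (y : Fin N → Request n → ℝ) (z : Fin N → Decision n) : Prop :=
  ∀ i, L.IsLocalOptimal i (fun j => min (y i j) 1) (z i)

end Linearization

end PDVRP

/-!
The coupling constraint is guaranteed by integrality together with a conservation law. The update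
of the allocations moves along differences of multipliers that are antisymmetric in the two ends of
each edge of the communication graph, so `∑ i, y t i j = δ` for every `t`
(`Linearization.IsRun.sum_allocation`). As `δ > 0`, for each request `j` some vehicle `i` has
`y Tf i j > 0`. Its local program forces the outflow of `j`, a natural number, to be at least
`min (y Tf i j) 1 > 0`, so it is at least `1`; the other vehicles contribute nonnegative terms.
The conservation law is exact at every iteration, so coverage holds for every `Tf` and does not
wait for the allocations to converge; `Tδ = 1` is a valid threshold.

Lagrange multipliers exist by convex duality. Only the arc variables enter the local linear
program, and they range over the convex hull of finitely many binary vectors, which is compact, so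
the minimum is attained (`Linearization.exists_isLeast_penalizedCost`). Large values of `v` satisfy
all the allocation constraints strictly, which is Slater's condition, and the multiplier comes from
separating a point from an open convex set (`ConvexOn.exists_lagrange_multiplier`). Both steps
work for every `M ≥ 0`, so `M₀ = 1` is a valid threshold.

If vehicle `i` can serve all the requests, then visiting them in the given order is a route through
every request (`Data.exists_isRoute_outflow_eq_one`). It is feasible for the final local program
because the allocations are thresholded at `1`, and an optimal solution exists because binary arc
variables give finitely many costs.
-/

/-! ### Lagrange multipliers under Slater's condition -/

/-- Convex duality under Slater's condition: a lower bound `p` for `f` on the part of `D` where all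
`g j ≤ 0` is also a lower bound on `D` for some Lagrangian with nonnegative multipliers. -/
theorem ConvexOn.exists_lagrange_multiplier {E ι : Type*} [AddCommGroup E] [Module ℝ E] [Fintype ι]
    {D : Set E} {f : E → ℝ} {g : ι → E → ℝ} (hf : ConvexOn ℝ D f)
    (hg : ∀ j, ConvexOn ℝ D (g j)) {x₀ : E} (hx₀ : x₀ ∈ D) (hslater : ∀ j, g j x₀ < 0)
    {p : ℝ} (hp : ∀ x ∈ D, (∀ j, g j x ≤ 0) → p ≤ f x) :
    ∃ μ : ι → ℝ, (∀ j, 0 ≤ μ j) ∧ ∀ x ∈ D, p ≤ f x + ∑ j, μ j * g j x := by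
  classical
  -- The strict epigraph of the perturbation function; it is open, convex and misses `(0, p)`.
  let A : Set ((ι → ℝ) × ℝ) := {w | ∃ x ∈ D, (∀ j, g j x < w.1 j) ∧ f x < w.2}
  have hAo : IsOpen A := by
    have : A = ⋃ x ∈ D, {w : (ι → ℝ) × ℝ | (∀ j, g j x < w.1 j) ∧ f x < w.2} := by
      ext w
      simp [A, and_left_comm]
    rw [this]
    refine isOpen_biUnion fun x _ => ?_
    rw [Set.ofPred_and, Set.ofPred_forall]
    refine (isOpen_iInter_of_finite fun j => ?_).inter ?_
    · exact isOpen_lt continuous_const (by fun_prop)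
    · exact isOpen_lt continuous_const (by fun_prop)
  have hAc : Convex ℝ A := by
    rw [convex_iff_forall_pos]
    rintro ⟨u, r⟩ ⟨x, hx, hgx, hfx⟩ ⟨u', r'⟩ ⟨x', hx', hgx', hfx'⟩ a b ha hb hab
    refine ⟨a • x + b • x', hf.1 hx hx' ha.le hb.le hab, fun j => ?_, ?_⟩
    · have h1 := (hg j).2 hx hx' ha.le hb.le hab
      have h2 := mul_lt_mul_of_pos_left (hgx j) ha
      have h3 := mul_lt_mul_of_pos_left (hgx' j) hb
      simp only [smul_eq_mul] at h1
      simp only [Prod.mk_add_mk, Prod.smul_mk, Pi.add_apply, Pi.smul_apply, smul_eq_mul]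
      linarith
    · have h1 := hf.2 hx hx' ha.le hb.le hab
      have h2 := mul_lt_mul_of_pos_left hfx ha
      have h3 := mul_lt_mul_of_pos_left hfx' hb
      simp only [smul_eq_mul] at h1
      simp only [Prod.mk_add_mk, Prod.smul_mk, smul_eq_mul]
      linarith
  have hpA : ((0 : ι → ℝ), p) ∉ A := by
    rintro ⟨x, hx, hgx, hfx⟩
    exact absurd (hp x hx fun j => (hgx j).le) (not_le.2 hfx)
  obtain ⟨φ, hφ⟩ := geometric_hahn_banach_point_open hAc hAo hpA
  let c : ι → ℝ := fun j => φ (Pi.single j 1, 0)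
  let c₀ : ℝ := φ (0, 1)
  have hφ_eq : ∀ u r, φ (u, r) = ∑ j, c j * u j + c₀ * r := by
    intro u r
    have h : ((u, r) : (ι → ℝ) × ℝ)
        = ∑ j, u j • ((Pi.single j 1, 0) : (ι → ℝ) × ℝ) + r • ((0, 1) : (ι → ℝ) × ℝ) := by
      ext k
      · simp [Prod.fst_sum, Finset.sum_apply, Pi.single_apply]
      · simp [Prod.snd_sum]
    rw [h, map_add, map_sum, map_smul]
    simp only [map_smul, smul_eq_mul, c, c₀, mul_comm]
  have hsep : ∀ x ∈ D, ∀ (u : ι → ℝ) (r : ℝ), (∀ j, g j x < u j) → f x < r →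
      c₀ * p < ∑ j, c j * u j + c₀ * r := by
    intro x hx u r hu hr
    have := hφ (u, r) ⟨x, hx, hu, hr⟩
    rw [hφ_eq, hφ_eq] at this
    simpa using this
  -- Slater's condition puts points `(0, r)` above `(0, p)` in the epigraph.
  have hc₀ : 0 < c₀ := by
    have h1 := hsep x₀ hx₀ 0 (max (f x₀) p + 1) (by simpa using hslater)
      (by linarith [le_max_left (f x₀) p])
    simp only [Pi.zero_apply, mul_zero, Finset.sum_const_zero, zero_add] at h1
    by_contra h
    have := mul_le_mul_of_nonpos_left
      (show p ≤ max (f x₀) p + 1 by linarith [le_max_right (f x₀) p]) (not_lt.1 h)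
    linarith
  have hc : ∀ j, 0 ≤ c j := by
    intro j
    by_contra! h
    let K := c₀ * (f x₀ + 1) - c₀ * p
    have hs : 0 ≤ |K| / (-c j) := div_nonneg (abs_nonneg _) (by linarith)
    have h1 := hsep x₀ hx₀ (Pi.single j (|K| / (-c j))) (f x₀ + 1)
      (fun k => by
        refine (hslater k).trans_le ?_
        by_cases hk : k = j
        · subst hk; simpa using hs
        · simp [hk]) (by linarith)
    have h2 : ∑ k, c k * (Pi.single j (|K| / (-c j)) : ι → ℝ) k = -|K| := by
      rw [Finset.sum_eq_single j (fun k _ hk => by simp [hk]) (by simp)]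
      simp only [Pi.single_eq_same]
      field_simp [h.ne]
    rw [h2] at h1
    have := le_abs_self K
    simp only [K] at this h1
    linarith
  refine ⟨fun j => c j / c₀, fun j => div_nonneg (hc j) hc₀.le, fun x hx => ?_⟩
  have key : c₀ * p ≤ ∑ j, c j * g j x + c₀ * f x := by
    refine le_of_forall_pos_lt_add fun ε hε => ?_
    let s := ∑ j, c j + c₀
    have hs : 0 < s := add_pos_of_nonneg_of_pos (Finset.sum_nonneg fun j _ => hc j) hc₀
    have h1 := hsep x hx (fun j => g j x + ε / s) (f x + ε / s)
      (fun j => by linarith [div_pos hε hs]) (by linarith [div_pos hε hs])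
    have h2 : ∑ j, c j * (g j x + ε / s) + c₀ * (f x + ε / s)
        = ∑ j, c j * g j x + c₀ * f x + s * (ε / s) := by
      simp only [mul_add, Finset.sum_add_distrib, ← Finset.sum_mul, s]
      ring
    rw [h2, mul_div_cancel₀ _ hs.ne'] at h1
    exact h1
  have h3 : f x + ∑ j, c j / c₀ * g j x = (∑ j, c j * g j x + c₀ * f x) / c₀ := by
    rw [add_div, mul_div_cancel_left₀ _ hc₀.ne', Finset.sum_div, add_comm]
    congr 1
    exact Finset.sum_congr rfl fun j _ => by ring
  rw [h3, le_div_iff₀ hc₀]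
  linarith

/-! ### Differences along the edges of a graph -/

theorem SimpleGraph.sum_sum_neighborFinset_sub {V : Type*} [Fintype V] (G : SimpleGraph V)
    [DecidableRel G.Adj] (f : V → ℝ) :
    ∑ i, ∑ l ∈ G.neighborFinset i, (f i - f l) = 0 := by
  have h : ∑ i, ∑ l ∈ G.neighborFinset i, f i = ∑ i, ∑ l ∈ G.neighborFinset i, f l :=
    Finset.sum_comm' fun i l => by simp [G.adj_comm]
  simp only [Finset.sum_sub_distrib] at h ⊢
  rw [h, sub_self]

namespace PDVRP

variable {N n : ℕ}

/-! ### Flows and binary arc variables -/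

theorem outflow_add (x x' : Edge n → ℝ) (j : Loc n) :
    outflow (x + x') j = outflow x j + outflow x' j := by
  simp [outflow, Finset.sum_add_distrib]

theorem outflow_smul (a : ℝ) (x : Edge n → ℝ) (j : Loc n) :
    outflow (a • x) j = a * outflow x j := by
  simp [outflow, Finset.mul_sum]

theorem continuous_outflow (j : Loc n) : Continuous fun x : Edge n → ℝ => outflow x j := by
  unfold outflow
  fun_prop

theorem outflow_nonneg {x : Edge n → ℝ} (hx : ∀ e, 0 ≤ x e) (j : Loc n) : 0 ≤ outflow x j :=
  Finset.sum_nonneg fun e _ => hx e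

theorem outflow_eq_zero_or_one_le {x : Edge n → ℝ} (hx : ∀ e, x e = 0 ∨ x e = 1) (j : Loc n) :
    outflow x j = 0 ∨ 1 ≤ outflow x j := by
  by_cases h : ∃ e : Edge n, e.1.1 = j ∧ x e = 1
  · obtain ⟨e, he, hxe⟩ := h
    right
    rw [← hxe]
    exact Finset.single_le_sum (f := x) (fun e _ => by rcases hx e with h | h <;> simp [h])
      (by simpa using he)
  · push Not at h
    left
    exact Finset.sum_eq_zero fun e he => (hx e).resolve_right (h e (by simpa using he))

theorem finite_binary : {x : Edge n → ℝ | ∀ e, x e = 0 ∨ x e = 1}.Finite := by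
  have := Set.Finite.pi' (ι := Edge n) (t := fun _ => ({0, 1} : Set ℝ)) fun _ => Set.toFinite _
  simpa using this

theorem Data.BasicConstraints.x_nonneg {S : Data N n} {i : Fin N} {z : Decision n}
    (h : S.BasicConstraints i z) (e : Edge n) : 0 ≤ z.x e := by
  rcases h.binary e with h | h <;> simp [h]

namespace Linearization

variable {S : Data N n} (L : Linearization S)

/-! ### The linearized constraints -/

variable {L} in
theorem IsLocal.isRoute {i : Fin N} {z : Decision n} (h : L.IsLocal i z) : S.IsRoute i z where
  toBasicConstraints := h.toBasicConstraints
  time_step e he := by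
    have := h.time_step e
    rw [he] at this
    linarith
  load_step e he := by
    have h1 := h.load_step_ge e
    have h2 := h.load_step_le e
    rw [he] at h1 h2
    linarith

theorem isLocal_of_isRoute {i : Fin N} {z : Decision n} (h : S.IsRoute i z)
    (hB : ∀ j, z.B j ≤ L.Bbar i) : L.IsLocal i z where
  toBasicConstraints := h.toBasicConstraints
  time_le := hB
  time_step e := by
    rcases h.binary e with he | he
    · rw [he]
      linarith [L.bigM_ge i e, hB e.1.1, h.time_nonneg e.1.2]
    · rw [he]
      linarith [h.time_step e he]
  load_step_ge e := by
    rcases h.binary e with he | he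
    · have h0 : 0 ≤ S.loadMin e.1.2 := le_max_left _ _
      rw [he]
      linarith [L.Wup_ge i e, h.load_upper e.1.1, h.load_lower e.1.2]
    · rw [he]
      linarith [h.load_step e he]
  load_step_le e := by
    rcases h.binary e with he | he
    · rw [he]
      linarith [L.Wlow_ge i e, h.load_upper e.1.2, h.load_lower e.1.1]
    · rw [he]
      linarith [h.load_step e he]

theorem exists_mem_Z_of_isRoute {i : Fin N} {z : Decision n} (h : S.IsRoute i z) :
    ∃ z' ∈ L.Z i, z'.x = z.x := by
  obtain ⟨B', hB', hle⟩ := L.preserves i z h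
  exact ⟨_, L.isLocal_of_isRoute hB' hle, rfl⟩

/-! ### Multipliers of the local linear programs -/

/-- The arc variables as a linear function of the decision. -/
def arcs (n : ℕ) : Decision n →ₗ[ℝ] (Edge n → ℝ) :=
  LinearMap.fst ℝ (Edge n → ℝ) ((Loc n → ℝ) × (Loc n → ℝ))

/-- The arc variables are all that matters for the objective and the allocation constraints, and
their convexified range is a polytope, although `Z i` itself is infinite. -/
theorem isCompact_arcs_image (i : Fin N) : IsCompact (arcs n '' convexHull ℝ (L.Z i)) := by
  rw [LinearMap.image_convexHull]
  refine Set.Finite.isCompact_convexHull ℝ (finite_binary.subset ?_)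
  rintro _ ⟨z, hz, rfl⟩
  exact hz.binary

theorem x_nonneg_of_mem_convexHull {i : Fin N} {z : Decision n} (hz : z ∈ convexHull ℝ (L.Z i))
    (e : Edge n) : 0 ≤ z.x e := by
  have hconv : Convex ℝ {z : Decision n | 0 ≤ z.x e} := by
    refine convex_halfSpace_ge (f := fun z : Decision n => z.x e) ⟨?_, ?_⟩ 0
    · exact fun _ _ => rfl
    · exact fun _ _ => rfl
  have hsub : L.Z i ⊆ {z : Decision n | 0 ≤ z.x e} := fun z hz => hz.x_nonneg e
  exact convexHull_min hsub hconv hz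

theorem exists_isLeast_penalizedCost {i : Fin N} (hZ : (L.Z i).Nonempty) {M : ℝ} (hM : 0 ≤ M)
    (y : Request n → ℝ) :
    ∃ p, IsLeast (L.penalizedCost i M '' L.relaxedFeasible i y) p := by
  -- With `v = V` all the allocation constraints hold, so larger values of `v` are not needed.
  let V : ℝ := ∑ j, |y j|
  have hV : 0 ≤ V := Finset.sum_nonneg fun j _ => abs_nonneg _
  have hyV : ∀ j, y j ≤ V := fun j => (le_abs_self _).trans
    (Finset.single_le_sum (f := fun j => |y j|) (fun j _ => abs_nonneg _) (Finset.mem_univ j))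
  let T : Set ((Edge n → ℝ) × ℝ) := (arcs n '' convexHull ℝ (L.Z i)) ×ˢ Set.Icc 0 V ∩
    {w | ∀ j, y j - w.2 ≤ outflow w.1 (Loc.req j)}
  have hT : IsCompact T := by
    refine ((L.isCompact_arcs_image i).prod isCompact_Icc).inter_right ?_
    rw [Set.ofPred_forall]
    exact isClosed_iInter fun j => isClosed_le (by fun_prop)
      ((continuous_outflow (Loc.req j)).comp continuous_fst)
  have hmem : ∀ z ∈ convexHull ℝ (L.Z i), (z.x, V) ∈ T := fun z hz =>
    ⟨⟨⟨z, hz, rfl⟩, hV, le_rfl⟩, fun j =>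
      (sub_nonpos.2 (hyV j)).trans (outflow_nonneg (L.x_nonneg_of_mem_convexHull hz) _)⟩
  obtain ⟨z₀, hz₀⟩ := hZ
  have hobj : Continuous fun w : (Edge n → ℝ) × ℝ => ∑ e, S.c i e * w.1 e + M * w.2 := by
    fun_prop
  obtain ⟨w, hw, hmin⟩ :=
    hT.exists_isMinOn ⟨_, hmem z₀ (subset_convexHull ℝ _ hz₀)⟩ hobj.continuousOn
  obtain ⟨⟨⟨z, hz, hzw⟩, hv⟩, hall⟩ := hw
  have hzw' : z.x = w.1 := hzw
  refine ⟨L.penalizedCost i M (z, w.2), ⟨(z, w.2), ⟨⟨hz, hv.1⟩, ?_⟩, rfl⟩, ?_⟩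
  · intro j
    rw [hzw']
    exact hall j
  · rintro _ ⟨⟨z', v'⟩, ⟨⟨hz', hv'⟩, hall'⟩, rfl⟩
    simp only [penalizedCost, Data.cost, hzw']
    by_cases hle : v' ≤ V
    · exact hmin (a := (z'.x, v')) ⟨⟨⟨z', hz', rfl⟩, hv', hle⟩, hall'⟩
    · refine (hmin (hmem z' hz')).trans ?_
      have := mul_le_mul_of_nonneg_left (not_le.1 hle).le hM
      simp only
      linarith

theorem exists_isLagrangeMultiplier {i : Fin N} (hZ : (L.Z i).Nonempty) {M : ℝ} (hM : 0 ≤ M)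
    (y : Request n → ℝ) : ∃ μ, L.IsLagrangeMultiplier i M y μ := by
  obtain ⟨p, hp⟩ := L.exists_isLeast_penalizedCost hZ hM y
  have hD : Convex ℝ (L.relaxedDomain i) := by
    have : L.relaxedDomain i = convexHull ℝ (L.Z i) ×ˢ Set.Ici 0 := by
      ext
      simp [relaxedDomain]
    rw [this]
    exact (convex_convexHull ℝ _).prod (convex_Ici 0)
  have hf : ConvexOn ℝ (L.relaxedDomain i) (L.penalizedCost i M) := by
    refine ⟨hD, fun p _ q _ a b _ _ _ => le_of_eq ?_⟩
    have hx : (a • p + b • q).1.x = a • p.1.x + b • q.1.x := rfl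
    simp only [penalizedCost, Data.cost, hx, Pi.add_apply, Pi.smul_apply, smul_eq_mul, mul_add,
      Finset.sum_add_distrib, Finset.mul_sum, Prod.snd_add, Prod.smul_snd, mul_left_comm]
    ring
  have hg : ∀ j, ConvexOn ℝ (L.relaxedDomain i)
      (fun p => y j - p.2 - outflow p.1.x (Loc.req j)) := by
    refine fun j => ⟨hD, fun p _ q _ a b _ _ hab => le_of_eq ?_⟩
    have hx : (a • p + b • q).1.x = a • p.1.x + b • q.1.x := rfl
    simp only [hx, outflow_add, outflow_smul, smul_eq_mul, Prod.snd_add, Prod.smul_snd]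
    linear_combination (-(y j)) * hab
  obtain ⟨z₀, hz₀⟩ := hZ
  have hV : ∀ j, y j ≤ ∑ j, |y j| := fun j => (le_abs_self _).trans
    (Finset.single_le_sum (f := fun j => |y j|) (fun j _ => abs_nonneg _) (Finset.mem_univ j))
  obtain ⟨μ, hμ, hbound⟩ := hf.exists_lagrange_multiplier hg (x₀ := (z₀, ∑ j, |y j| + 1))
    (p := p) ⟨subset_convexHull ℝ _ hz₀,
      add_nonneg (Finset.sum_nonneg fun j _ => abs_nonneg _) zero_le_one⟩
    (fun j => by linarith [hV j, outflow_nonneg (fun e => hz₀.x_nonneg e) (Loc.req j)])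
    (fun w hw hgw => hp.2 ⟨w, ⟨hw, fun j => sub_nonpos.1 (hgw j)⟩, rfl⟩)
  refine ⟨μ, hμ, p, hp, ?_, ?_⟩
  · rintro _ ⟨w, hw, rfl⟩
    exact hbound w hw
  · obtain ⟨w, hw, hwp⟩ := hp.1
    refine fun b hb => (hb ⟨w, hw.1, rfl⟩).trans ?_
    rw [lagrangian, hwp]
    have : ∑ j, μ j * (y j - w.2 - outflow w.1.x (Loc.req j)) ≤ 0 :=
      Finset.sum_nonpos fun j _ =>
        mul_nonpos_of_nonneg_of_nonpos (hμ j) (sub_nonpos.2 (hw.2 j))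
    linarith

/-! ### Allocations along a run and coverage of the requests -/

variable {L} in
/-- The iterations preserve the total allocation of each request. -/
theorem IsRun.sum_allocation {G : SimpleGraph (Fin N)} [DecidableRel G.Adj] {α : ℕ → ℝ}
    {δ M : ℝ} {Tf : ℕ} {y μ : ℕ → Fin N → Request n → ℝ} (h : L.IsRun G α δ M Tf y μ)
    (hN : N ≠ 0) (j : Request n) : ∀ t ≤ Tf, ∑ i, y t i j = δ := by
  intro t
  induction t with
  | zero =>
    intro _
    simp only [h.initial, Finset.sum_const, Finset.card_univ, Fintype.card_fin, nsmul_eq_mul]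
    field_simp
  | succ t ih =>
    intro ht
    simp only [h.update t ht, Finset.sum_sub_distrib (f := fun i => y t i j), ← Finset.mul_sum,
      G.sum_sum_neighborFinset_sub (fun i => μ t i j), ih (by omega), mul_zero, sub_zero]

variable {L} in
/-- Integrality turns any positive total allocation into full coverage. -/
theorem IsReturned.covers {y : Fin N → Request n → ℝ} {z : Fin N → Decision n}
    (h : L.IsReturned y z) (hy : ∀ j, 0 < ∑ i, y i j) : S.Covers z := by
  intro j
  obtain ⟨i, -, hi⟩ : ∃ i ∈ Finset.univ, 0 < y i j := by
    by_contra! hneg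
    exact absurd (Finset.sum_nonpos hneg) (not_le.2 (hy j))
  have hpos : 0 < outflow (z i).x (Loc.req j) :=
    (lt_min hi one_pos).trans_le ((h i).1.2 j)
  have hone := (outflow_eq_zero_or_one_le (h i).1.1.binary (Loc.req j)).resolve_left hpos.ne'
  exact hone.trans (Finset.single_le_sum (f := fun i => outflow (z i).x (Loc.req j))
    (fun i _ => outflow_nonneg (fun e => (h i).1.1.x_nonneg e) _) (Finset.mem_univ i))

theorem exists_isLocalOptimal {i : Fin N} {y : Request n → ℝ}
    (h : ∃ z ∈ L.Z i, ∀ j, y j ≤ outflow z.x (Loc.req j)) : ∃ z, L.IsLocalOptimal i y z := by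
  let F : Set (Decision n) := {z | z ∈ L.Z i ∧ ∀ j, y j ≤ outflow z.x (Loc.req j)}
  have hfin : (S.cost i '' F).Finite := by
    refine (finite_binary.image fun x : Edge n → ℝ => ∑ e, S.c i e * x e).subset ?_
    rintro _ ⟨z, hz, rfl⟩
    exact ⟨z.x, hz.1.binary, rfl⟩
  obtain ⟨z₀, hz₀⟩ := h
  obtain ⟨_, ⟨z, hz, rfl⟩, hmin⟩ := hfin.exists_minimal ⟨_, z₀, hz₀, rfl⟩
  refine ⟨z, hz, fun z' hz' hy' => ?_⟩
  by_contra! hlt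
  exact absurd (hmin ⟨z', ⟨hz', hy'⟩, rfl⟩ hlt.le) (not_le.2 hlt)

end Linearization

/-! ### A route through all the requests -/

/-- The position of a location on the tour that serves the requests in the order `r`: the start
has position `0`, the requests `1, …, 2 n` and the terminal `2 n + 1`. -/
def tourPosition (r : Fin (2 * n) ≃ Request n) : Loc n → ℕ
  | .start => 0
  | .req k => r.symm k + 1
  | .terminal => 2 * n + 1

theorem tourPosition_req (r : Fin (2 * n) ≃ Request n) (k : Request n) :
    tourPosition r (.req k) = r.symm k + 1 := rfl

theorem tourPosition_terminal (r : Fin (2 * n) ≃ Request n) :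
    tourPosition r .terminal = 2 * n + 1 := rfl

/-- The arc variables of the tour: the arcs between consecutive positions are travelled. -/
def tourArcs (r : Fin (2 * n) ≃ Request n) (e : Edge n) : ℝ :=
  if tourPosition r e.1.2 = tourPosition r e.1.1 + 1 then 1 else 0

theorem tourPosition_injective (r : Fin (2 * n) ≃ Request n) :
    Function.Injective (tourPosition r) := by
  intro j k h
  rcases j with _ | j | _ <;> rcases k with _ | k | _ <;> simp only [tourPosition] at h
  · rfl
  · omega
  · omega
  · omega
  · congr 1
    exact r.symm.injective (Fin.ext (by omega))
  · have := (r.symm j).2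
    omega
  · omega
  · have := (r.symm k).2
    omega
  · rfl

theorem exists_tourPosition_eq (r : Fin (2 * n) ≃ Request n) {m : ℕ} (hm : m ≤ 2 * n + 1) :
    ∃ j, tourPosition r j = m := by
  rcases Nat.eq_zero_or_pos m with rfl | h0
  · exact ⟨.start, rfl⟩
  rcases hm.lt_or_eq with h | rfl
  · refine ⟨.req (r ⟨m - 1, by omega⟩), ?_⟩
    simp only [tourPosition, Equiv.symm_apply_apply]
    omega
  · exact ⟨.terminal, rfl⟩

theorem tourPosition_lt {r : Fin (2 * n) ≃ Request n} {j : Loc n} (hj : j ≠ .terminal) :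
    tourPosition r j < 2 * n + 1 := by
  rcases j with _ | j | _
  · simp [tourPosition]
  · have := (r.symm j).2
    simp only [tourPosition]
    omega
  · exact absurd rfl hj

theorem tourPosition_pos {r : Fin (2 * n) ≃ Request n} {j : Loc n} (hj : j ≠ .start) :
    0 < tourPosition r j := by
  rcases j with _ | j | _
  · exact absurd rfl hj
  · simp [tourPosition]
  · simp [tourPosition]

theorem outflow_tourArcs (r : Fin (2 * n) ≃ Request n) {j : Loc n} (hj : j ≠ .terminal) :
    outflow (tourArcs r) j = 1 := by
  obtain ⟨k, hk⟩ := exists_tourPosition_eq r (Nat.succ_le_of_lt (tourPosition_lt (r := r) hj))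
  have hjk : j ≠ k := by rintro rfl; omega
  have hks : k ≠ .start := by rintro rfl; simp [tourPosition] at hk
  rw [outflow, Finset.sum_eq_single ⟨(j, k), hjk, hj, hks⟩]
  · simp [tourArcs, hk]
  · rintro ⟨⟨j', k'⟩, he⟩ hmem hne
    obtain rfl : j' = j := by simpa using hmem
    refine if_neg fun h => hne ?_
    simp only at h
    obtain rfl : k' = k := tourPosition_injective r (by omega)
    rfl
  · simp

theorem inflow_tourArcs (r : Fin (2 * n) ≃ Request n) {k : Loc n} (hk : k ≠ .start) :
    inflow (tourArcs r) k = 1 := by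
  have hpos := tourPosition_pos (r := r) hk
  have hle : tourPosition r k ≤ 2 * n + 1 := by
    by_cases h : k = .terminal
    · subst h; rfl
    · exact (tourPosition_lt h).le
  obtain ⟨j, hj⟩ := exists_tourPosition_eq r (m := tourPosition r k - 1) (by omega)
  have hjk : j ≠ k := by rintro rfl; omega
  have hjt : j ≠ .terminal := by
    rintro rfl
    rw [tourPosition_terminal] at hj
    omega
  rw [inflow, Finset.sum_eq_single ⟨(j, k), hjk, hjt, hk⟩]
  · have : tourPosition r k = tourPosition r j + 1 := by omega
    simp [tourArcs, this]
  · rintro ⟨⟨j', k'⟩, he⟩ hmem hne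
    obtain rfl : k' = k := by simpa using hmem
    refine if_neg fun h => hne ?_
    simp only at h
    obtain rfl : j' = j := tourPosition_injective r (by omega)
    rfl
  · simp

namespace Data

variable {S : Data N n}

/-- The load of vehicle `i` after it has served the first `m` requests in the order `r`. -/
noncomputable def tourLoad (S : Data N n) (i : Fin N) (r : Fin (2 * n) ≃ Request n) (m : ℕ) : ℝ :=
  S.Q₀ i + ∑ l : Fin (2 * n) with l.val < m, S.q (Loc.req (r l))

theorem tourLoad_zero (S : Data N n) (i : Fin N) (r : Fin (2 * n) ≃ Request n) :
    S.tourLoad i r 0 = S.Q₀ i := by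
  simp [tourLoad]

theorem tourLoad_succ (S : Data N n) (i : Fin N) (r : Fin (2 * n) ≃ Request n)
    (m : Fin (2 * n)) :
    S.tourLoad i r (m + 1) = S.Q₀ i + ∑ l ∈ Finset.Iic m, S.q (Loc.req (r l)) := by
  have : ({l : Fin (2 * n) | l.val < m.val + 1} : Finset _) = Finset.Iic m := by
    ext l
    simp only [Finset.mem_filter_univ, Finset.mem_Iic, Fin.le_def]
    omega
  rw [tourLoad, this]

theorem tourLoad_succ_eq_add (S : Data N n) (i : Fin N) (r : Fin (2 * n) ≃ Request n)
    (m : Fin (2 * n)) :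
    S.tourLoad i r (m + 1) = S.tourLoad i r m + S.q (Loc.req (r m)) := by
  have : ({l : Fin (2 * n) | l.val < m.val + 1} : Finset _)
      = insert m ({l : Fin (2 * n) | l.val < m.val} : Finset _) := by
    ext l
    simp only [Finset.mem_filter_univ, Finset.mem_insert, Fin.ext_iff]
    omega
  rw [tourLoad, tourLoad, this, Finset.sum_insert (by simp)]
  ring

theorem tourLoad_full (S : Data N n) (i : Fin N) (r : Fin (2 * n) ≃ Request n) :
    S.tourLoad i r (2 * n + 1) = S.tourLoad i r (2 * n) := by
  rw [tourLoad, tourLoad]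
  congr 2
  ext l
  have := l.2
  simp only [Finset.mem_filter_univ]
  omega

/-- A vehicle with sufficient capacity has a route through all the requests. -/
theorem exists_isRoute_outflow_eq_one {i : Fin N} (hC : S.Q₀ i ≤ S.C i)
    (h : S.CanServeAll i) :
    ∃ z, S.IsRoute i z ∧ ∀ j : Request n, outflow z.x (Loc.req j) = 1 := by
  obtain ⟨r, hprec, hload⟩ := h
  -- `K` bounds the time from the beginning of a service to the beginning of the next one.
  let K : ℝ := ∑ j, S.d j + ∑ e, S.t i e
  have hd : ∀ j, S.d j ≤ ∑ j, S.d j := fun j =>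
    Finset.single_le_sum (fun j _ => S.d_nonneg j) (Finset.mem_univ j)
  have ht : ∀ e, S.t i e ≤ ∑ e, S.t i e := fun e =>
    Finset.single_le_sum (fun e _ => S.t_nonneg i e) (Finset.mem_univ e)
  have hK : 0 ≤ K := add_nonneg (Finset.sum_nonneg fun j _ => S.d_nonneg j)
    (Finset.sum_nonneg fun e _ => S.t_nonneg i e)
  have hbounds : ∀ j, S.loadMin j ≤ S.tourLoad i r (tourPosition r j) ∧
      S.tourLoad i r (tourPosition r j) ≤ S.loadMax i j := by
    intro j
    rcases j with _ | k | _
    · simp [tourPosition, tourLoad_zero, loadMin, loadMax, S.q_start, S.Q₀_nonneg, hC]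
    · have := hload (r.symm k)
      rwa [← tourLoad_succ, Equiv.apply_symm_apply] at this
    · simp only [tourPosition, tourLoad_full, loadMin, loadMax, S.q_terminal, max_self, add_zero,
        min_self]
      rcases Nat.eq_zero_or_pos n with rfl | hn
      · simp [tourLoad_zero, S.Q₀_nonneg, hC]
      · have hlast := hload ⟨2 * n - 1, by omega⟩
        rw [← tourLoad_succ, show 2 * n - 1 + 1 = 2 * n by omega] at hlast
        exact ⟨(le_max_left _ _).trans hlast.1, hlast.2.trans (min_le_left _ _)⟩
  refine ⟨(tourArcs r, fun j => tourPosition r j * K, fun j => S.tourLoad i r (tourPosition r j)),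
    ?_, fun j => outflow_tourArcs r (by simp)⟩
  refine ⟨⟨?_, ?_, ?_, ?_, ?_, ?_, ?_, ?_, ?_, ?_⟩, ?_, ?_⟩
  · exact outflow_tourArcs r (by simp)
  · exact inflow_tourArcs r (by simp)
  · exact fun k => (inflow_tourArcs r (by simp)).trans (outflow_tourArcs r (by simp)).symm
  · exact fun j => (outflow_tourArcs r (by simp)).trans (outflow_tourArcs r (by simp)).symm
  · intro j
    refine mul_le_mul_of_nonneg_right ?_ hK
    have := Fin.lt_def.1 (hprec j)
    simp only [tourPosition]
    exact_mod_cast (by omega)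
  · exact fun j => mul_nonneg (Nat.cast_nonneg _) hK
  · exact fun j => (hbounds j).1
  · exact fun j => (hbounds j).2
  · exact S.tourLoad_zero i r
  · intro e
    simp only [Decision.x, tourArcs]
    split_ifs <;> simp
  · intro e he
    have hpos : tourPosition r e.1.2 = tourPosition r e.1.1 + 1 := by
      by_contra hne
      simp [Decision.x, tourArcs, hne] at he
    simp only [Decision.B, hpos, Nat.cast_add, Nat.cast_one]
    have := hd e.1.1
    have := ht e
    simp only [K]
    linarith
  · rintro ⟨⟨j, k⟩, hjk, hjt, hks⟩ he
    have hpos : tourPosition r k = tourPosition r j + 1 := by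
      by_contra hne
      simp [Decision.x, tourArcs, hne] at he
    simp only [Decision.Q]
    rcases k with _ | k | _
    · exact absurd rfl hks
    · have hj : tourPosition r j = r.symm k := by
        rw [tourPosition_req] at hpos
        omega
      rw [hpos, hj, tourLoad_succ_eq_add, Equiv.apply_symm_apply]
    · have hj : tourPosition r j = 2 * n := by
        rw [tourPosition_terminal] at hpos
        omega
      rw [hpos, hj, tourLoad_full, S.q_terminal, add_zero]

end Data

end PDVRP

theorem theorem1 {N n : ℕ} (S : PDVRP.Data N n) (L : PDVRP.Linearization S)
    (hS : ∃ z : Fin N → PDVRP.Decision n, S.IsOptimal z)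
    (G : SimpleGraph (Fin N)) [DecidableRel G.Adj] (hG : G.Connected)
    (α : ℕ → ℝ) (hα : ∀ t, 0 ≤ α t) (hα_sum : ¬ Summable α)
    (hα_sq : Summable fun t => α t ^ 2)
    (δ : ℝ) (hδ : 0 < δ) (hδ' : δ < 1) :
    ∃ M₀ : ℝ, 0 < M₀ ∧ ∀ M : ℝ, M₀ ≤ M →
      (∀ (i : Fin N) (y : PDVRP.Request n → ℝ), ∃ μ, L.IsLagrangeMultiplier i M y μ) ∧
      ∃ Tδ : ℕ, 0 < Tδ ∧ ∀ Tf : ℕ, Tδ ≤ Tf →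
        ∀ y μ : ℕ → Fin N → PDVRP.Request n → ℝ, L.IsRun G α δ M Tf y μ →
          (∀ z : Fin N → PDVRP.Decision n, L.IsReturned (y Tf) z →
            L.IsFeasible z ∧ S.IsFeasible z) ∧
          ((∀ i, S.CanServeAll i) → ∃ z : Fin N → PDVRP.Decision n, L.IsReturned (y Tf) z) := by
  have hN : N ≠ 0 := by
    rintro rfl
    exact hG.nonempty.elim fun i => i.elim0
  obtain ⟨z₀, ⟨hroute, -⟩, -⟩ := hS
  have hZ : ∀ i, (L.Z i).Nonempty := fun i =>
    let ⟨z, hz, _⟩ := L.exists_mem_Z_of_isRoute (hroute i)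
    ⟨z, hz⟩
  refine ⟨1, one_pos, fun M hM => ⟨fun i y =>
    L.exists_isLagrangeMultiplier (hZ i) (zero_le_one.trans hM) y, 1, one_pos,
    fun Tf _ y μ hrun => ⟨fun z hz => ?_, fun hserve => ?_⟩⟩⟩
  · have hcov : S.Covers z := hz.covers fun j => by
      rwa [hrun.sum_allocation hN j Tf le_rfl]
    exact ⟨⟨fun i => (hz i).1.1, hcov⟩, fun i => (hz i).1.1.isRoute, hcov⟩
  · refine Classical.skolem.1 fun i => L.exists_isLocalOptimal ?_
    have hC : S.Q₀ i ≤ S.C i := by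
      rw [← (hroute i).load_start]
      exact ((hroute i).load_upper _).trans (min_le_left _ _)
    obtain ⟨z, hz, hone⟩ := PDVRP.Data.exists_isRoute_outflow_eq_one hC (hserve i)
    obtain ⟨z', hz', hx⟩ := L.exists_mem_Z_of_isRoute hz
    refine ⟨z', hz', fun j => ?_⟩
    rw [hx, hone j]
    exact min_le_right _ _
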